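/- Let $R=\mathbb{F}_2[w_1,w_2,w_3,\dots]$ be the polynomial ring graded by $\deg w_i=i$, put $w_0=1$, and let $\omega\colon R\to R$, $x\mapsto\bar x$, be the $\mathbb{F}_2$-algebra involution determined recursively by $\bar w_0=1$ and $\sum_{i=0}^{k} w_i\bar w_{k-i}=0$ for $k\ge 1$. (Equivalently, $R$ is the ring of symmetric functions over $\mathbb{F}_2$ with the involution exchanging the elementary and the complete homogeneous symmetric functions.) Let $S=R^\omega$ be the subring of $\omega$-invariant elements and let $I=\{x+\bar x : x\in R\}$, an ideal of $S$. Let $p_k\in S$, $k\ge1$, be the power sums, defined recursively by Newton's identity $k w_k=\sum_{j=0}^{k-1}p_{k-j}w_j$. Let $PS\subset S$ be the subring generated by all $p_k$, $k\ge 1$, with the grading inherited from $R$, and let $Q(PS)$ be the ideal of $PS$ generated by the squares $x^2$ of all homogeneous elements $x\in PS$ of strictly positive degree. Then the ring $S/I$ is the exterior algebra over $\mathbb{F}_2$ on the vector space spanned by the $p_k$ with $k$ odd. Precisely: the elements $p_1,p_3,p_5,\dots$ of $S$ are linearly independent over $\mathbb{F}_2$, and, if $V\subset S$ denotes their linear span,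 the map $V\to S/I$, $v\mapsto v+I$, extends to an isomorphism of $\mathbb{F}_2$-algebras $\bigwedge(V)\to S/I$. Moreover, the inclusion $PS\subset S$ induces an isomorphism of $\mathbb{F}_2$-algebras $PS/Q(PS)\to S/I$. -/

import Mathlib

noncomputable section

namespace SymInv

/-- The polynomial ring `R = 𝔽₂[w₁, w₂, w₃, …]`; the variable with index `i` is `w_{i+1}`. -/
abbrev R : Type := MvPolynomial ℕ (ZMod 2)

/-- The element `w_k` of `R`, with the convention `w_0 = 1`. -/
def w : ℕ → R
  | 0 => 1
  | k + 1 => MvPolynomial.X k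

/-- The elements `w̄_k` of `R`, determined recursively by `w̄_0 = 1` and
`∑_{i=0}^{k} w_i w̄_{k-i} = 0` for `k ≥ 1`. -/
def wBar : ℕ → R
  | 0 => 1
  | k + 1 => - ∑ i : Fin (k + 1), w (i + 1) * wBar (k - i)
  decreasing_by omega

/-- The algebra endomorphism `ω` of `R` with `ω(w_k) = w̄_k`. -/
def omega : R →ₐ[ZMod 2] R := MvPolynomial.aeval fun i => wBar (i + 1)

/-- The power sums `p_k ∈ R` for `k ≥ 1` (and `p_0 = 0` by convention), determined recursively by
the Newton identity `k w_k = ∑_{j=0}^{k-1} p_{k-j} w_j`. -/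
def p : ℕ → R
  | 0 => 0
  | k + 1 => ((k + 1 : ℕ) : R) * w (k + 1) - ∑ j : Fin k, p (k - j) * w (j + 1)
  decreasing_by omega

/-- The recursion defining `w̄`, in its usual form. -/
theorem sum_w_mul_wBar (k : ℕ) (hk : 1 ≤ k) :
    ∑ i ∈ Finset.range (k + 1), w i * wBar (k - i) = 0 := by
  obtain ⟨k, rfl⟩ : ∃ m, k = m + 1 := ⟨k - 1, by omega⟩
  rw [Finset.sum_range_succ']
  simp only [Nat.sub_zero, Nat.add_sub_add_right]
  rw [wBar, Fin.sum_univ_eq_sum_range (fun i => w (i + 1) * wBar (k - i))]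
  simp [w]

/-- The Newton identity defining the power sums, in its usual form. -/
theorem newton (k : ℕ) (hk : 1 ≤ k) :
    (k : R) * w k = ∑ j ∈ Finset.range k, p (k - j) * w j := by
  obtain ⟨k, rfl⟩ : ∃ m, k = m + 1 := ⟨k - 1, by omega⟩
  rw [Finset.sum_range_succ']
  simp only [Nat.sub_zero, Nat.add_sub_add_right]
  rw [p, Fin.sum_univ_eq_sum_range (fun j => p (k - j) * w (j + 1))]
  simp [w]

theorem omega_w (k : ℕ) : omega (w k) = wBar k := by
  cases k with
  | zero => simp [w, wBar]
  | succ k => simp [w, omega]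

/-- The generating series identity `(∑ w_k T^k) (∑ w̄_k T^k) = 1`. -/
theorem mk_w_mul_mk_wBar : PowerSeries.mk w * PowerSeries.mk wBar = 1 := by
  ext1 n
  rw [PowerSeries.coeff_mul, Finset.Nat.sum_antidiagonal_eq_sum_range_succ_mk]
  simp only [PowerSeries.coeff_mk, PowerSeries.coeff_one]
  cases n with
  | zero => simp [w, wBar]
  | succ n => simpa using sum_w_mul_wBar (n + 1) (by omega)

theorem map_mk_w :
    PowerSeries.map (omega : R →+* R) (PowerSeries.mk w) = PowerSeries.mk wBar := by
  ext1 n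
  simp [omega_w]

theorem omega_wBar (k : ℕ) : omega (wBar k) = w k := by
  have h := congrArg (PowerSeries.map (omega : R →+* R)) mk_w_mul_mk_wBar
  rw [map_mul, map_one, map_mk_w] at h
  have h2 : PowerSeries.map (omega : R →+* R) (PowerSeries.mk wBar) = PowerSeries.mk w := by
    calc _ = (PowerSeries.mk w * PowerSeries.mk wBar) *
          PowerSeries.map (omega : R →+* R) (PowerSeries.mk wBar) := by
            rw [mk_w_mul_mk_wBar, one_mul]
      _ = _ := by rw [mul_assoc, h, mul_one]
  simpa using congrArg (PowerSeries.coeff k) h2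

/-- `ω` is an involution. -/
theorem omega_omega (x : R) : omega (omega x) = x := by
  have h : omega.comp omega = AlgHom.id (ZMod 2) R := by
    apply MvPolynomial.algHom_ext
    intro i
    have h1 := omega_w (i + 1)
    have h2 := omega_wBar (i + 1)
    simp only [w] at h1 h2
    simp [h1, h2]
  exact DFunLike.congr_fun h x

/-- The generating series form of the Newton identity. -/
theorem mk_p_mul_mk_w : PowerSeries.mk p * PowerSeries.mk w =
    PowerSeries.X * PowerSeries.derivative R (PowerSeries.mk w) := by
  ext1 n
  rw [mul_comm, PowerSeries.coeff_mul, Finset.Nat.sum_antidiagonal_eq_sum_range_succ_mk]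
  simp only [PowerSeries.coeff_mk]
  cases n with
  | zero => simp [p]
  | succ n =>
    rw [Finset.sum_range_succ, PowerSeries.coeff_succ_X_mul, PowerSeries.coeff_derivative]
    have h := newton (n + 1) (by omega)
    simp only [PowerSeries.coeff_mk]
    simp only [mul_comm (w _)]
    rw [← h]
    simp [p]

/-- The power sums are invariant under `ω`. -/
theorem omega_p (k : ℕ) : omega (p k) = p k := by
  have h1 := mk_p_mul_mk_w
  have h2 := congrArg (PowerSeries.map (omega : R →+* R)) h1
  have hd : PowerSeries.map (omega : R →+* R) (PowerSeries.derivative R (PowerSeries.mk w)) =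
      PowerSeries.derivative R (PowerSeries.mk wBar) := by
    ext1 n
    simp [PowerSeries.coeff_derivative, omega_w]
  rw [map_mul, map_mul, map_mk_w, hd, PowerSeries.map_X] at h2
  have h3 := congrArg (PowerSeries.derivative R) mk_w_mul_mk_wBar
  rw [Derivation.leibniz, Derivation.map_one_eq_zero] at h3
  simp only [smul_eq_mul] at h3
  have key : PowerSeries.map (omega : R →+* R) (PowerSeries.mk p) + PowerSeries.mk p = 0 := by
    have hw := mk_w_mul_mk_wBar
    generalize PowerSeries.map (omega : R →+* R) (PowerSeries.mk p) = P' at *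
    generalize PowerSeries.derivative R (PowerSeries.mk w) = A at *
    generalize PowerSeries.derivative R (PowerSeries.mk wBar) = B at *
    linear_combination (-(P' + PowerSeries.mk p)) * hw + PowerSeries.mk w * h2 +
      PowerSeries.mk wBar * h1 + PowerSeries.X * h3
  have h4 := congrArg (PowerSeries.coeff k) key
  simp only [map_add, PowerSeries.coeff_map, PowerSeries.coeff_mk, map_zero] at h4
  exact CharTwo.add_eq_zero.mp h4

/-- The subalgebra `S = R^ω` of `ω`-invariant elements. -/
def S : Subalgebra (ZMod 2) R := AlgHom.equalizer omega (AlgHom.id (ZMod 2) R)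

theorem mem_S {x : R} : x ∈ S ↔ omega x = x := Iff.rfl

/-- The `S`-linear map `d : R → S`, `d x = x + ω(x)`. -/
def d : R →ₗ[S] S where
  toFun x := ⟨x + omega x, by rw [mem_S, map_add, omega_omega, add_comm]⟩
  map_add' x y := Subtype.ext (by simp only [map_add, Subalgebra.coe_add]; ring)
  map_smul' s x := Subtype.ext (by
    have hs : omega (s : R) = s := mem_S.mp s.2
    simp only [Subalgebra.smul_def, smul_eq_mul, map_mul, hs, RingHom.id_apply,
      Subalgebra.coe_mul]
    ring)

/-- The ideal `I = {x + ω(x) : x ∈ R}` of `S`. -/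
def I : Ideal S := LinearMap.range d

theorem mem_I {s : S} : s ∈ I ↔ ∃ x : R, x + omega x = (s : R) := by
  constructor
  · rintro ⟨x, rfl⟩
    exact ⟨x, rfl⟩
  · rintro ⟨x, hx⟩
    exact ⟨x, Subtype.ext hx⟩

/-- The power sum `p_k` as an element of `S`. -/
def pS (k : ℕ) : S := ⟨p k, mem_S.mpr (omega_p k)⟩

/-- The subalgebra `PS` of `R` generated by all power sums `p_k`, `k ≥ 1`. -/
def PS : Subalgebra (ZMod 2) R := Algebra.adjoin (ZMod 2) {x | ∃ k : ℕ, 1 ≤ k ∧ x = p k}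

/-- `PS` is contained in `S`. -/
theorem PS_le_S : PS ≤ S := by
  refine Algebra.adjoin_le ?_
  rintro x ⟨k, -, rfl⟩
  exact mem_S.mpr (omega_p k)

/-- The degree `n` part of `R` for the grading with `deg w_i = i`. -/
def gradeR (n : ℕ) : Submodule (ZMod 2) R :=
  MvPolynomial.weightedHomogeneousSubmodule (ZMod 2) (fun i : ℕ => i + 1) n

/-- The degree `n` part of `PS` for the grading inherited from `R`. -/
def gradePS (n : ℕ) : Submodule (ZMod 2) PS :=
  (gradeR n).comap PS.val.toLinearMap

/-- The ideal of squares `Q(A)` of an `𝔽₂`-algebra `A` with degree `n` part `𝒜 n`: the ideal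
generated by the squares of the homogeneous elements of positive degree. -/
def idealOfSquares {A : Type*} [CommRing A] [Algebra (ZMod 2) A]
    (𝒜 : ℕ → Submodule (ZMod 2) A) : Ideal A :=
  Ideal.span {y | ∃ n : ℕ, 0 < n ∧ ∃ x ∈ 𝒜 n, y = x ^ 2}

/-- The ideal of squares `Q(PS)` of the graded ring `PS`. -/
def QPS : Ideal PS := idealOfSquares gradePS

/-- The linear span of the power sums `p_k` with `k` odd. -/
def V : Submodule (ZMod 2) S := Submodule.span (ZMod 2) {x | ∃ k : ℕ, Odd k ∧ x = pS k}

end SymInv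

end

/-!
Write `d x = x + ω(x)` and `N x = x ω(x)`. The proof exhibits a basis of `R` over `𝔽₂` that is
permuted by `ω` and whose fixed elements are the products of distinct odd power sums. For a
permuted basis, the invariants modulo the image of `d` have the fixed basis elements as a basis
(`exists_sub_linearCombination_mem_I`, `eq_zero_of_linearCombination_mem_I`), so the products of
distinct odd power sums form a basis `invBasis` of `S / I`.

*Generators.* Folding `∑ w_i w̄_{2k-i} = 0` about its middle term shows that `N w_k = d z` with `z`
congruent to `w_{2k}` modulo decomposable elements. Modulo `I` the norm `N` is additive and
multiplicative, so `N x ∈ I` for all `x` of positive degree (`exists_lift_norm`); in particular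
squares of invariant elements of positive degree lie in `I`. It also follows that there are
polynomial generators `g_k` of `R` with `g_k = p_k` for odd `k` and
`g_{2k} + ω(g_{2k}) = g_k ω(g_k)` (`g_spec`).

*Basis.* The basis elements `mono (s, f)` are the products of distinct odd power sums and, for each
even `k`, of a power of `g_k` or a power of `ω(g_k)`, but not of both. They span, because the
relation for `g_{2k}` replaces a forbidden product `g_k ω(g_k)` by two products of the same degree
with fewer factors (`g_mul_mono_mem`). They are linearly independent by counting: there are at
most as many of them in each degree as monomials in the `w_k`, by the injection `lead`, which
sends a basis element to what would be its leading monomial in the `g_k` if `g_k ω(g_k)` dominates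
`g_{2k}`.

*Conclusion.* The basis of `⋀ V` given by the odd power sums is sent to `invBasis`. Since
`p_{2k} = p_k ^ 2` (`p_two_mul`), the ring `PS / Q(PS)` is spanned by the products of distinct odd
power sums as well, and these are sent to `invBasis`.
-/

noncomputable section

namespace SymInv

/-! ### The grading of `R` and its decomposable elements -/

theorem mul_mem_gradeR {i j : ℕ} {x y : R} (hx : x ∈ gradeR i) (hy : y ∈ gradeR j) :
    x * y ∈ gradeR (i + j) :=
  MvPolynomial.IsWeightedHomogeneous.mul hx hy

theorem one_mem_gradeR : (1 : R) ∈ gradeR 0 :=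
  MvPolynomial.isWeightedHomogeneous_one _ _

theorem w_mem_gradeR (k : ℕ) : w k ∈ gradeR k := by
  cases k with
  | zero => exact one_mem_gradeR
  | succ k => exact MvPolynomial.isWeightedHomogeneous_X _ _ _

theorem wBar_mem_gradeR (k : ℕ) : wBar k ∈ gradeR k := by
  induction k using Nat.strong_induction_on with
  | _ k ih =>
    cases k with
    | zero => rw [wBar]; exact one_mem_gradeR
    | succ k =>
      rw [wBar]
      refine neg_mem (sum_mem fun i _ => ?_)
      have := mul_mem_gradeR (w_mem_gradeR (i + 1)) (ih (k - i) (by omega))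
      rwa [show (i : ℕ) + 1 + (k - i) = k + 1 by omega] at this

theorem p_mem_gradeR (k : ℕ) : p k ∈ gradeR k := by
  induction k using Nat.strong_induction_on with
  | _ k ih =>
    cases k with
    | zero => rw [p]; exact zero_mem _
    | succ k =>
      rw [p]
      refine sub_mem ?_ (sum_mem fun i _ => ?_)
      · rw [← nsmul_eq_mul]
        exact nsmul_mem (w_mem_gradeR _) _
      · have := mul_mem_gradeR (ih (k - i) (by omega)) (w_mem_gradeR (i + 1))
        rwa [show k - (i : ℕ) + (i + 1) = k + 1 by omega] at this

theorem omega_mem_gradeR {n : ℕ} {x : R} (hx : x ∈ gradeR n) : omega x ∈ gradeR n := by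
  rw [x.as_sum, map_sum]
  refine sum_mem fun m hm => ?_
  have hw : Finsupp.weight (fun i : ℕ => i + 1) m = n := hx (MvPolynomial.mem_support_iff.mp hm)
  rw [omega, MvPolynomial.aeval_monomial, ← Algebra.smul_def]
  refine Submodule.smul_mem _ _ ?_
  have : MvPolynomial.IsWeightedHomogeneous (fun i : ℕ => i + 1)
      (∏ i ∈ m.support, wBar (i + 1) ^ m i) (∑ i ∈ m.support, m i • (i + 1)) :=
    MvPolynomial.IsWeightedHomogeneous.prod _ _ _ fun i _ =>
      MvPolynomial.IsWeightedHomogeneous.pow (wBar_mem_gradeR (i + 1)) (m i)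
  rw [← hw]
  exact this

/-- The decomposable elements of degree `n`: sums of products of two homogeneous elements of
positive degree. -/
def Dec (n : ℕ) : Submodule (ZMod 2) R :=
  Submodule.span (ZMod 2)
    {x | ∃ i j : ℕ, 0 < i ∧ 0 < j ∧ i + j = n ∧ ∃ a ∈ gradeR i, ∃ b ∈ gradeR j, x = a * b}

theorem mul_mem_Dec {i j n : ℕ} (hi : 0 < i) (hj : 0 < j) (h : i + j = n) {a b : R}
    (ha : a ∈ gradeR i) (hb : b ∈ gradeR j) : a * b ∈ Dec n :=
  Submodule.subset_span ⟨i, j, hi, hj, h, a, ha, b, hb, rfl⟩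

theorem Dec_le_gradeR (n : ℕ) : Dec n ≤ gradeR n := by
  refine Submodule.span_le.mpr ?_
  rintro _ ⟨i, j, -, -, rfl, a, ha, b, hb, rfl⟩
  exact mul_mem_gradeR ha hb

/-- In positive degree, `w_n` spans a complement of the decomposable elements. -/
theorem exists_sub_smul_w_mem_Dec {n : ℕ} (hn : 0 < n) {x : R} (hx : x ∈ gradeR n) :
    ∃ c : ZMod 2, x - c • w n ∈ Dec n := by
  have key : gradeR n ≤ Submodule.span (ZMod 2) {w n} ⊔ Dec n := by
    intro x hx
    rw [x.as_sum]
    refine sum_mem fun m hm => ?_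
    have hw : Finsupp.weight (fun i : ℕ => i + 1) m = n := hx (MvPolynomial.mem_support_iff.mp hm)
    have hm0 : m ≠ 0 := by
      rintro rfl
      simp at hw
      omega
    obtain ⟨i, hi⟩ := Finsupp.support_nonempty_iff.mpr hm0
    obtain ⟨m', rfl⟩ : ∃ m', m = Finsupp.single i 1 + m' :=
      ⟨m - Finsupp.single i 1, (add_tsub_cancel_of_le (by
        rw [Finsupp.single_le_iff]
        exact Nat.one_le_iff_ne_zero.mpr (Finsupp.mem_support_iff.mp hi))).symm⟩
    rw [map_add, Finsupp.weight_single, smul_eq_mul, one_mul] at hw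
    generalize MvPolynomial.coeff _ x = c
    have hmon : MvPolynomial.monomial (Finsupp.single i 1 + m') c =
        w (i + 1) * MvPolynomial.monomial m' c := by
      rw [w, MvPolynomial.X, MvPolynomial.monomial_mul, one_mul]
    rw [hmon]
    rcases Nat.eq_zero_or_pos (Finsupp.weight (fun i : ℕ => i + 1) m') with h0 | hpos
    · have hm' : m' = 0 := by
        by_contra hne
        obtain ⟨j, hj⟩ := Finsupp.support_nonempty_iff.mpr hne
        have := Finsupp.le_weight (fun i : ℕ => i + 1) (by simp : j + 1 ≠ 0) m'
        rw [h0] at this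
        exact Finsupp.mem_support_iff.mp hj (by omega)
      subst hm'
      refine Submodule.mem_sup_left ?_
      rw [show i + 1 = n by omega, Submodule.mem_span_singleton]
      exact ⟨c, by rw [Algebra.smul_def, mul_comm]; rfl⟩
    · exact Submodule.mem_sup_right (mul_mem_Dec (Nat.succ_pos i) hpos hw (w_mem_gradeR _)
        (MvPolynomial.isWeightedHomogeneous_monomial _ _ _ rfl))
  obtain ⟨y, hy, z, hz, rfl⟩ := Submodule.mem_sup.mp (key hx)
  obtain ⟨c, rfl⟩ := Submodule.mem_span_singleton.mp hy
  exact ⟨c, by simpa using hz⟩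

/-! ### Norms are boundaries in positive degree -/

/-- Folding a sum of an odd number of terms about its middle term. -/
theorem sum_range_fold {M : Type*} [AddCommMonoid M] (f : ℕ → M) (k : ℕ) :
    ∑ i ∈ Finset.range (2 * k + 1), f i =
      ∑ i ∈ Finset.range k, (f i + f (2 * k - i)) + f k := by
  have h : ∑ i ∈ Finset.range k, f (2 * k - i) = ∑ i ∈ Finset.range k, f (k + (i + 1)) := by
    rw [← Finset.sum_range_reflect]
    refine Finset.sum_congr rfl fun i hi => ?_
    rw [Finset.mem_range] at hi
    congr 1
    omega
  rw [show 2 * k + 1 = k + (k + 1) by ring, Finset.sum_range_add, Finset.sum_range_succ',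
    Finset.sum_add_distrib, h]
  simp only [add_zero, add_assoc]

/-- The norm of `w_k` is `z + ω(z)` for an element `z` that is indecomposable of degree `2k`:
the terms of `∑ w_i w̄_{2k-i} = 0` other than the middle one are exchanged in pairs by `ω`. -/
theorem exists_lift_norm_w {k : ℕ} (hk : 0 < k) :
    ∃ z : R, z - w (2 * k) ∈ Dec (2 * k) ∧ z + omega z = w k * omega (w k) := by
  refine ⟨∑ i ∈ Finset.range k, wBar i * w (2 * k - i), ?_, ?_⟩
  · obtain ⟨k, rfl⟩ : ∃ m, k = m + 1 := ⟨k - 1, by omega⟩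
    rw [Finset.sum_range_succ']
    rw [show wBar 0 = 1 by rw [wBar], Nat.sub_zero, one_mul, add_sub_cancel_right]
    refine sum_mem fun i hi => ?_
    have hi := Finset.mem_range.mp hi
    have hj : 0 < 2 * (k + 1) - (i + 1) := by omega
    have hij : i + 1 + (2 * (k + 1) - (i + 1)) = 2 * (k + 1) := by omega
    exact mul_mem_Dec i.succ_pos hj hij (wBar_mem_gradeR _) (w_mem_gradeR _)
  · have h := sum_w_mul_wBar (2 * k) (by omega)
    rw [sum_range_fold, show 2 * k - k = k by omega, CharTwo.add_eq_zero] at h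
    rw [omega_w, ← h, map_sum, ← Finset.sum_add_distrib]
    refine Finset.sum_congr rfl fun i hi => ?_
    rw [Finset.mem_range] at hi
    rw [map_mul, omega_w, omega_wBar, show 2 * k - (2 * k - i) = i by omega]
    ring

/-- The norm `x ω(x)` is additive up to elements of the form `z + ω(z)`. -/
theorem exists_lift_norm_add {n : ℕ} (hn : 0 < n) {x y z t : R} (hx : x ∈ gradeR n)
    (hy : y ∈ gradeR n) (hz : z + omega z = x * omega x) (ht : t + omega t = y * omega y) :
    ∃ u, u - (z + t) ∈ Dec (2 * n) ∧ u + omega u = (x + y) * omega (x + y) := by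
  refine ⟨z + t + x * omega y, ?_, ?_⟩
  · rw [add_sub_cancel_left]
    exact mul_mem_Dec hn hn (two_mul n).symm hx (omega_mem_gradeR hy)
  · simp only [map_add, map_mul, omega_omega]
    linear_combination hz + ht

theorem exists_lift_norm_smul {x z : R} (c : ZMod 2) (hz : z + omega z = x * omega x) :
    c • z + omega (c • z) = (c • x) * omega (c • x) := by
  rcases (by decide : ∀ c : ZMod 2, c = 0 ∨ c = 1) c with rfl | rfl
  · simp
  · simpa using hz

/-- Norms of decomposable elements come from decomposable elements, provided that norms are
of the form `z + ω(z)` in all lower degrees. -/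
theorem exists_lift_norm_Dec_of_lt {n : ℕ}
    (ih : ∀ m < n, 0 < m → ∀ x ∈ gradeR m, ∃ z ∈ gradeR (2 * m), z + omega z = x * omega x)
    (hn : 0 < n) {x : R} (hx : x ∈ Dec n) :
    ∃ z ∈ Dec (2 * n), z + omega z = x * omega x := by
  induction hx using Submodule.span_induction with
  | mem x hx =>
    obtain ⟨i, j, hi, hj, h, a, ha, b, hb, rfl⟩ := hx
    obtain ⟨z, hz, hza⟩ := ih i (by omega) hi a ha
    have hb2 := mul_mem_gradeR hb (omega_mem_gradeR hb)
    refine ⟨z * (b * omega b), mul_mem_Dec (by omega) (by omega) (by omega) hz hb2, ?_⟩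
    simp only [map_mul, omega_omega]
    linear_combination (b * omega b) * hza
  | zero => exact ⟨0, zero_mem _, by simp⟩
  | add x y hx hy hzx hzy =>
    obtain ⟨z, hz, hzx⟩ := hzx
    obtain ⟨t, ht, hty⟩ := hzy
    obtain ⟨u, hu, hu2⟩ := exists_lift_norm_add hn (Dec_le_gradeR _ hx) (Dec_le_gradeR _ hy) hzx hty
    exact ⟨u, by simpa using add_mem hu (add_mem hz ht), hu2⟩
  | smul c x _ hzx =>
    obtain ⟨z, hz, hzx⟩ := hzx
    exact ⟨c • z, Submodule.smul_mem _ _ hz, exists_lift_norm_smul c hzx⟩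

/-- In positive degree, every norm `x ω(x)` is of the form `z + ω(z)`. -/
theorem exists_lift_norm {n : ℕ} (hn : 0 < n) {x : R} (hx : x ∈ gradeR n) :
    ∃ z ∈ gradeR (2 * n), z + omega z = x * omega x := by
  induction n using Nat.strong_induction_on generalizing x with
  | _ n ih =>
    obtain ⟨c, hc⟩ := exists_sub_smul_w_mem_Dec hn hx
    obtain ⟨t, ht, hty⟩ := exists_lift_norm_Dec_of_lt (fun m hm h0 x hx => ih m hm h0 hx) hn hc
    obtain ⟨z, hz, hzx⟩ := exists_lift_norm_w hn
    have hz' : z ∈ gradeR (2 * n) := by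
      simpa using add_mem (Dec_le_gradeR _ hz) (w_mem_gradeR (2 * n))
    obtain ⟨u, hu, hu2⟩ := exists_lift_norm_add hn (Submodule.smul_mem _ c (w_mem_gradeR n))
      (Dec_le_gradeR _ hc) (exists_lift_norm_smul c hzx) hty
    refine ⟨u, ?_, by simpa using hu2⟩
    simpa using add_mem (Dec_le_gradeR _ hu)
      (add_mem (Submodule.smul_mem _ c hz') (Dec_le_gradeR _ ht))

/-- If `x` can replace `w_n` as a polynomial generator, then its norm is `z + ω(z)` for some `z`
that can replace `w_{2n}`. -/
theorem exists_lift_norm_generator {n : ℕ} (hn : 0 < n) {x : R} (hx : x - w n ∈ Dec n) :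
    ∃ z : R, z - w (2 * n) ∈ Dec (2 * n) ∧ z + omega z = x * omega x := by
  obtain ⟨t, ht, hty⟩ := exists_lift_norm_Dec_of_lt (fun m _ h0 x hx => exists_lift_norm h0 hx)
    hn hx
  obtain ⟨z, hz, hzx⟩ := exists_lift_norm_w hn
  obtain ⟨u, hu, hu2⟩ := exists_lift_norm_add hn (w_mem_gradeR n) (Dec_le_gradeR _ hx) hzx hty
  refine ⟨u, ?_, by simpa using hu2⟩
  have := add_mem hu (add_mem hz ht)
  rwa [show u - (z + t) + (z - w (2 * n) + t) = u - w (2 * n) by ring] at this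

/-! ### Polynomial generators adapted to the involution -/

theorem p_succ (k : ℕ) :
    p (k + 1) = ((k + 1 : ℕ) : R) * w (k + 1) - ∑ j : Fin k, p (k - j) * w (j + 1) := by
  rw [p]

theorem p_sub_w_mem_Dec {k : ℕ} (hk : Odd k) : p k - w k ∈ Dec k := by
  obtain ⟨m, rfl⟩ := hk
  have h : ((2 * m + 1 : ℕ) : R) = 1 := by
    simp [CharTwo.two_eq_zero (R := R)]
  rw [p_succ, h, one_mul, sub_sub_cancel_left]
  refine neg_mem (sum_mem fun i _ => ?_)
  exact mul_mem_Dec (by omega) (by omega) (by omega) (p_mem_gradeR (2 * m - i))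
    (w_mem_gradeR (i + 1))

/-- An element `z` congruent to `w_{2k}` modulo decomposables with `z + ω(z) = x ω(x)`,
whenever there is one. -/
def liftNorm (k : ℕ) (x : R) : R :=
  Classical.epsilon fun z => z - w (2 * k) ∈ Dec (2 * k) ∧ z + omega z = x * omega x

/-- Polynomial generators `g_k` of `R` on which `ω` takes the form `ω(g_k) = g_k = p_k` for odd
`k` and `ω(g_{2k}) = g_{2k} + g_k ω(g_k)`; the value at `0` is irrelevant. -/
def g (k : ℕ) : R :=
  if Odd k then p k else if k = 0 then 0 else liftNorm (k / 2) (g (k / 2))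
  decreasing_by omega

theorem g_odd {k : ℕ} (hk : Odd k) : g k = p k := by
  rw [g, if_pos hk]

theorem g_spec {k : ℕ} (hk : 0 < k) : g k - w k ∈ Dec k ∧
    g (2 * k) - w (2 * k) ∈ Dec (2 * k) ∧ g (2 * k) + omega (g (2 * k)) = g k * omega (g k) := by
  induction k using Nat.strong_induction_on with
  | _ k ih =>
    have h1 : g k - w k ∈ Dec k := by
      rcases Nat.even_or_odd' k with ⟨m, rfl | rfl⟩
      · exact (ih m (by omega) (by omega)).2.1
      · have ho : Odd (2 * m + 1) := odd_two_mul_add_one m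
        rw [g_odd ho]
        exact p_sub_w_mem_Dec ho
    have h2 : g (2 * k) = liftNorm k (g k) := by
      rw [g, if_neg (by simp), if_neg (by omega), Nat.mul_div_cancel_left k two_pos]
    rw [h2]
    exact ⟨h1, Classical.epsilon_spec (exists_lift_norm_generator hk h1)⟩

theorem g_sub_w_mem_Dec {k : ℕ} (hk : 0 < k) : g k - w k ∈ Dec k := (g_spec hk).1

theorem g_add_omega_g {k : ℕ} (hk : 0 < k) :
    g (2 * k) + omega (g (2 * k)) = g k * omega (g k) := (g_spec hk).2.2

/-! ### A spanning set permuted by the involution -/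

/-- For `a : ℤ`, the power `g_k ^ a` if `a ≥ 0` and `ω(g_k) ^ (-a)` if `a ≤ 0`. -/
def gPow (k : ℕ) (a : ℤ) : R := g k ^ a.toNat * omega (g k) ^ (-a).toNat

theorem gPow_zero (k : ℕ) : gPow k 0 = 1 := by simp [gPow]

theorem omega_gPow (k : ℕ) (a : ℤ) : omega (gPow k a) = gPow k (-a) := by
  simp only [gPow, map_mul, map_pow, omega_omega, neg_neg]
  ring

theorem g_mul_gPow_of_nonneg (k : ℕ) {a : ℤ} (ha : 0 ≤ a) : g k * gPow k a = gPow k (a + 1) := by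
  obtain ⟨n, rfl⟩ := Int.eq_ofNat_of_zero_le ha
  rw [gPow, gPow, show (-(n : ℤ)).toNat = 0 by omega, show (-((n : ℤ) + 1)).toNat = 0 by omega,
    show ((n : ℤ) + 1).toNat = n + 1 by omega, Int.toNat_natCast]
  ring

theorem gPow_of_neg (k : ℕ) {a : ℤ} (ha : a < 0) : gPow k a = omega (g k) * gPow k (a + 1) := by
  rw [gPow, gPow, show a.toNat = 0 by omega, show (a + 1).toNat = 0 by omega,
    show (-a).toNat = (-(a + 1)).toNat + 1 by omega]
  ring

/-- Index set of a basis of `R` that is permuted by `ω`. The pair `(s, f)` stands for the product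
of the `p_{2i+1}` with `i ∈ s` and of the powers `g_{2i+2} ^ (f i)`, where a negative exponent
refers to `ω(g_{2i+2})`. -/
abbrev Idx : Type := Finset ℕ × (ℕ →₀ ℤ)

/-- The element of `R` with index `(s, f)`. -/
def mono (j : Idx) : R :=
  (∏ i ∈ j.1, p (2 * i + 1)) * j.2.prod fun i a => gPow (2 * (i + 1)) a

/-- The degree of `mono j`. -/
def wt (j : Idx) : ℕ :=
  ∑ i ∈ j.1, (2 * i + 1) + j.2.sum fun i a => 2 * (i + 1) * a.natAbs

/-- The number of factors of `mono j`. -/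
def len (j : Idx) : ℕ := j.1.card + j.2.sum fun _ a => a.natAbs

/-- The involution of the index set that corresponds to `ω`. -/
def conj (j : Idx) : Idx := (j.1, -j.2)

theorem conj_conj (j : Idx) : conj (conj j) = j := by simp [conj]

theorem omega_mono (j : Idx) : omega (mono j) = mono (conj j) := by
  simp only [mono, conj, map_mul, map_prod, omega_p]
  rw [Finsupp.prod_neg_index (fun i => gPow_zero _), map_finsuppProd]
  simp only [omega_gPow]

theorem wt_conj (j : Idx) : wt (conj j) = wt j := by
  simp only [wt, conj]
  rw [Finsupp.sum_neg_index (fun i => by simp)]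
  simp

theorem len_conj (j : Idx) : len (conj j) = len j := by
  simp only [len, conj]
  rw [Finsupp.sum_neg_index (fun i => by simp)]
  simp

theorem mono_update (s : Finset ℕ) (f : ℕ →₀ ℤ) (i : ℕ) (a : ℤ) :
    mono (s, f.update i a) = gPow (2 * (i + 1)) a * mono (s, f.erase i) := by
  simp only [mono]
  rw [← Finsupp.mul_prod_erase' (f.update i a) i _ (fun i => gPow_zero _)]
  simp only [Finsupp.update_apply, if_pos, Finsupp.erase_update_eq_erase]
  ring

theorem wt_update (s : Finset ℕ) (f : ℕ →₀ ℤ) (i : ℕ) (a : ℤ) :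
    wt (s, f.update i a) = 2 * (i + 1) * a.natAbs + wt (s, f.erase i) := by
  simp only [wt]
  rw [← Finsupp.add_sum_erase' (f.update i a) i _ (fun i => by simp)]
  simp only [Finsupp.update_apply, if_pos, Finsupp.erase_update_eq_erase]
  ring

theorem len_update (s : Finset ℕ) (f : ℕ →₀ ℤ) (i : ℕ) (a : ℤ) :
    len (s, f.update i a) = a.natAbs + len (s, f.erase i) := by
  simp only [len]
  rw [← Finsupp.add_sum_erase' (f.update i a) i _ (fun i => by simp)]
  simp only [Finsupp.update_apply, if_pos, Finsupp.erase_update_eq_erase]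
  ring

/-- The span of the elements `mono j` of degree `n`. -/
def monoSpan (n : ℕ) : Submodule (ZMod 2) R := Submodule.span (ZMod 2) (mono '' {j | wt j = n})

theorem mono_mem_monoSpan {j : Idx} {n : ℕ} (h : wt j = n) : mono j ∈ monoSpan n :=
  Submodule.subset_span ⟨j, h, rfl⟩

theorem omega_mem_monoSpan {n : ℕ} {x : R} (hx : x ∈ monoSpan n) : omega x ∈ monoSpan n := by
  induction hx using Submodule.span_induction with
  | mem x hx =>
    obtain ⟨j, hj, rfl⟩ := hx
    rw [omega_mono]
    exact mono_mem_monoSpan ((wt_conj j).trans hj)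
  | zero => rw [map_zero]; exact zero_mem _
  | add x y _ _ hx hy => rw [map_add]; exact add_mem hx hy
  | smul c x _ hx => rw [map_smul]; exact Submodule.smul_mem _ _ hx

theorem omega_g_mul_mem_monoSpan {k n : ℕ} {j : Idx} (h : g k * mono (conj j) ∈ monoSpan n) :
    omega (g k) * mono j ∈ monoSpan n := by
  have := omega_mem_monoSpan h
  rwa [map_mul, omega_mono, conj_conj] at this

/-- Multiplication by a generator preserves the span of the elements `mono j`. A product that
contains both `g_k` and `ω(g_k)` is rewritten with `g_k ω(g_k) = g_{2k} + ω(g_{2k})`, which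
preserves the degree and reduces the number of factors. -/
theorem g_mul_mono_mem (j : Idx) (k : ℕ) : g (k + 1) * mono j ∈ monoSpan (k + 1 + wt j) := by
  induction hN : len j using Nat.strong_induction_on generalizing j k with
  | _ N ih =>
    have key : ∀ (j' : Idx) (k' : ℕ), len j' < N → 2 * (k' + 1) + wt j' = k + 1 + wt j →
        g (k' + 1) * omega (g (k' + 1)) * mono j' ∈ monoSpan (k + 1 + wt j) := by
      intro j' k' hl hw
      rw [← g_add_omega_g (Nat.succ_pos k'), add_mul, ← hw]
      have h1 := ih (len j') hl j' (2 * k' + 1) rfl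
      have h2 := ih (len (conj j')) (by rwa [len_conj]) (conj j') (2 * k' + 1) rfl
      rw [wt_conj] at h2
      exact add_mem h1 (omega_g_mul_mem_monoSpan h2)
    obtain ⟨s, f⟩ := j
    rcases Nat.even_or_odd' k with ⟨i, rfl | rfl⟩
    · have ho : Odd (2 * i + 1) := odd_two_mul_add_one i
      by_cases hi : i ∈ s
      · have hm : mono (s, f) = p (2 * i + 1) * mono (s.erase i, f) := by
          simp only [mono]
          rw [← Finset.mul_prod_erase s _ hi, mul_assoc]
        have hl : len (s, f) = 1 + len (s.erase i, f) := by
          simp only [len]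
          rw [← Finset.card_erase_add_one hi]
          ring
        have hw : wt (s, f) = 2 * i + 1 + wt (s.erase i, f) := by
          simp only [wt]
          rw [← Finset.add_sum_erase s _ hi, add_assoc]
        have := key (s.erase i, f) (2 * i) (by omega) (by omega)
        rwa [g_odd ho, omega_p, mul_assoc, ← hm, ← g_odd ho] at this
      · have hm : g (2 * i + 1) * mono (s, f) = mono (insert i s, f) := by
          simp only [mono]
          rw [Finset.prod_insert hi, mul_assoc, g_odd ho]
        rw [hm]
        refine mono_mem_monoSpan ?_
        simp only [wt]
        rw [Finset.sum_insert hi, add_assoc]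
    · have hm := mono_update s f i (f i)
      have hw := wt_update s f i (f i)
      have hl := len_update s f i (f i)
      have hm' := mono_update s f i (f i + 1)
      have hw' := wt_update s f i (f i + 1)
      have hl' := len_update s f i (f i + 1)
      rw [Finsupp.update_self] at hm hw hl
      rw [show 2 * i + 1 + 1 = 2 * (i + 1) by ring] at *
      rcases le_or_gt 0 (f i) with h0 | h0
      · rw [hm, ← mul_assoc, g_mul_gPow_of_nonneg _ h0, ← hm']
        refine mono_mem_monoSpan ?_
        rw [hw, hw', show (f i + 1).natAbs = (f i).natAbs + 1 by omega]
        ring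
      · have habs : (f i).natAbs = (f i + 1).natAbs + 1 := by omega
        have := key (s, f.update i (f i + 1)) (2 * i + 1) (by omega) (by
          rw [hw, hw', habs]
          ring)
        rwa [show 2 * i + 1 + 1 = 2 * (i + 1) by ring, hm', mul_assoc, ← mul_assoc (omega _),
          ← gPow_of_neg _ h0, ← hm] at this

/-- The elements of `R` that multiply `monoSpan n` into `monoSpan (k + n)` for all `n`. -/
def monoMul (k : ℕ) : Submodule (ZMod 2) R where
  carrier := {x | ∀ n, ∀ y ∈ monoSpan n, x * y ∈ monoSpan (k + n)}
  add_mem' hx hx' n y hy := by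
    rw [add_mul]
    exact add_mem (hx n y hy) (hx' n y hy)
  zero_mem' n y _ := by
    rw [zero_mul]
    exact zero_mem _
  smul_mem' c x hx n y hy := by
    rw [smul_mul_assoc]
    exact Submodule.smul_mem _ _ (hx n y hy)

theorem g_mem_monoMul (k : ℕ) : g (k + 1) ∈ monoMul (k + 1) := by
  intro n y hy
  induction hy using Submodule.span_induction with
  | mem x hx =>
    obtain ⟨j, rfl, rfl⟩ := hx
    exact g_mul_mono_mem j k
  | zero => rw [mul_zero]; exact zero_mem _
  | add x y _ _ hx hy => rw [mul_add]; exact add_mem hx hy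
  | smul c x _ hx => rw [mul_smul_comm]; exact Submodule.smul_mem _ _ hx

theorem gradeR_le_monoMul (n : ℕ) : gradeR n ≤ monoMul n := by
  induction n using Nat.strong_induction_on with
  | _ n ih =>
    intro x hx
    rcases Nat.eq_zero_or_pos n with rfl | hn
    · have hx0 : x = MvPolynomial.C (MvPolynomial.coeff 0 x) := by
        ext m
        rw [MvPolynomial.coeff_C]
        split_ifs with h
        · rw [h]
        · by_contra hne
          obtain ⟨i, hi⟩ := Finsupp.support_nonempty_iff.mpr (Ne.symm h)
          have := Finsupp.le_weight (fun i : ℕ => i + 1) (by simp : i + 1 ≠ 0) m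
          rw [hx hne] at this
          exact Finsupp.mem_support_iff.mp hi (by omega)
      intro n y hy
      rw [hx0, ← MvPolynomial.smul_eq_C_mul, zero_add]
      exact Submodule.smul_mem _ _ hy
    · have hDec : Dec n ≤ monoMul n := by
        refine Submodule.span_le.mpr ?_
        rintro _ ⟨i, j, hi, hj, rfl, a, ha, b, hb, rfl⟩ m y hy
        rw [mul_assoc, add_assoc]
        exact ih i (by omega) ha _ _ (ih j (by omega) hb _ _ hy)
      obtain ⟨c, hc⟩ := exists_sub_smul_w_mem_Dec hn hx
      have hw : w n ∈ monoMul n := by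
        have h1 := hDec (g_sub_w_mem_Dec hn)
        have h2 : g n ∈ monoMul n := by
          obtain ⟨k, rfl⟩ : ∃ k, n = k + 1 := ⟨n - 1, by omega⟩
          exact g_mem_monoMul k
        simpa using sub_mem h2 h1
      simpa using add_mem (hDec hc) (Submodule.smul_mem _ c hw)

theorem gradeR_le_monoSpan (n : ℕ) : gradeR n ≤ monoSpan n := by
  intro x hx
  have h : (1 : R) ∈ monoSpan 0 := by
    have := mono_mem_monoSpan (j := (∅, 0)) (n := 0) (by simp [wt])
    simpa [mono] using this
  simpa using gradeR_le_monoMul n hx 0 1 h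

/-! ### Linear independence by counting -/

/-- The exponent of the monomial obtained from `ω(g_{v+1})` by iterating
`ω(g_{2k}) = g_k ω(g_k) + g_{2k}` and retaining only the first term. The variable with index `v`
has degree `v + 1`. -/
def conjExp (v : ℕ) : ℕ →₀ ℕ :=
  if Odd v then Finsupp.single (v / 2) 1 + conjExp (v / 2) else Finsupp.single v 1
  termination_by v
  decreasing_by
    have : v ≠ 0 := by rintro rfl; simp_all
    omega

theorem conjExp_even (u : ℕ) : conjExp (2 * u) = Finsupp.single (2 * u) 1 := by
  rw [conjExp, if_neg (by simp)]

theorem conjExp_odd (u : ℕ) : conjExp (2 * u + 1) = Finsupp.single u 1 + conjExp u := by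
  rw [conjExp, if_pos (odd_two_mul_add_one u), show (2 * u + 1) / 2 = u by omega]

theorem weight_conjExp (v : ℕ) : Finsupp.weight (fun i : ℕ => i + 1) (conjExp v) = v + 1 := by
  induction v using Nat.strong_induction_on with
  | _ v ih =>
    rcases Nat.even_or_odd' v with ⟨u, rfl | rfl⟩
    · simp [conjExp_even, Finsupp.weight_single]
    · rw [conjExp_odd, map_add, ih u (by omega), Finsupp.weight_single]
      simp only [smul_eq_mul]
      ring

/-- Equal to `1` if `v` is obtained from `n` by applying `2u + 1 ↦ u` at least once, and to `0`
otherwise. -/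
def descends (n v : ℕ) : ℕ :=
  if Odd n then (if n / 2 = v then 1 else 0) + descends (n / 2) v else 0
  termination_by n
  decreasing_by
    have : n ≠ 0 := by rintro rfl; simp_all
    omega

theorem descends_even (u v : ℕ) : descends (2 * u) v = 0 := by
  rw [descends, if_neg (by simp)]

theorem descends_odd (u v : ℕ) :
    descends (2 * u + 1) v = (if u = v then 1 else 0) + descends u v := by
  rw [descends, if_pos (odd_two_mul_add_one u), show (2 * u + 1) / 2 = u by omega]

theorem descends_eq (n v : ℕ) :
    descends n v = (if n = 2 * v + 1 then 1 else 0) + descends n (2 * v + 1) := by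
  induction n using Nat.strong_induction_on with
  | _ n ih =>
    rcases Nat.even_or_odd' n with ⟨u, rfl | rfl⟩
    · rw [descends_even, descends_even, if_neg (by omega)]
    · have h : 2 * u + 1 = 2 * v + 1 ↔ u = v := by omega
      rw [descends_odd, descends_odd, ih u (by omega)]
      simp only [h]

/-- An even index (an odd degree) is where the descent from `2i + 1` ends, and the last step
`ω(g_k) = g_k` makes the variable occur twice. -/
theorem conjExp_apply (i v : ℕ) :
    conjExp (2 * i + 1) v = (if Odd v then 1 else 2) * descends (2 * i + 1) v := by
  induction i using Nat.strong_induction_on with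
  | _ i ih =>
    rw [conjExp_odd, descends_odd, Finsupp.add_apply, Finsupp.single_apply]
    rcases Nat.even_or_odd' i with ⟨u, rfl | rfl⟩
    · rw [conjExp_even, descends_even, Finsupp.single_apply]
      by_cases h1 : 2 * u = v
      · rw [if_pos h1, if_neg (by simp [← h1])]
      · simp [h1]
    · rw [ih u (by omega)]
      by_cases h1 : 2 * u + 1 = v
      · rw [← h1, if_pos (odd_two_mul_add_one u)]
        ring
      · simp [h1]

/-- A monomial of degree `wt j` attached to `mono j`. It is the product of the monomials attached
to the factors, `ω(g_{2i+2})` contributing `conjExp (2i + 1)`. -/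
def lead (j : Idx) : ℕ →₀ ℕ :=
  ∑ i ∈ j.1, Finsupp.single (2 * i) 1 + j.2.sum fun i a =>
    (a.toNat • Finsupp.single (2 * i + 1) 1 + (-a).toNat • conjExp (2 * i + 1))

theorem weight_lead (j : Idx) : Finsupp.weight (fun i : ℕ => i + 1) (lead j) = wt j := by
  rw [lead, wt, map_add, map_sum, Finsupp.sum, map_sum, Finsupp.sum]
  congr 1
  · simp [Finsupp.weight_single]
  · refine Finset.sum_congr rfl fun i _ => ?_
    rw [map_add, map_nsmul, map_nsmul, weight_conjExp, Finsupp.weight_single]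
    simp only [smul_eq_mul]
    rw [show (j.2 i).natAbs = (j.2 i).toNat + (-(j.2 i)).toNat by omega]
    ring

/-- The multiplicity of `v` among the proper descents of the negative part of `f`. -/
def negMult (f : ℕ →₀ ℤ) (v : ℕ) : ℕ :=
  f.sum fun i a => (-a).toNat * descends (2 * i + 1) v

theorem negMult_eq (f : ℕ →₀ ℤ) (v : ℕ) :
    negMult f v = (-(f v)).toNat + negMult f (2 * v + 1) := by
  have h : (-(f v)).toNat = f.sum fun i a => if i = v then (-a).toNat else 0 := by
    rw [Finsupp.sum_ite_eq' f v fun _ a => (-a).toNat]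
    split_ifs with hv
    · rfl
    · rw [Finsupp.notMem_support_iff.mp hv]
      rfl
  rw [h, negMult, negMult, ← Finsupp.sum_add]
  refine Finsupp.sum_congr fun i _ => ?_
  rw [descends_eq (2 * i + 1) v]
  by_cases hi : i = v
  · simp [hi, mul_add]
  · simp [hi]

theorem lead_apply_even (j : Idx) (u : ℕ) :
    lead j (2 * u) = (if u ∈ j.1 then 1 else 0) + 2 * negMult j.2 (2 * u) := by
  rw [lead, negMult, Finsupp.add_apply, Finsupp.finsetSum_apply, Finsupp.sum_apply,
    Finsupp.sum, Finsupp.sum, Finset.mul_sum]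
  congr 1
  · simp [Finsupp.single_apply]
  · refine Finset.sum_congr rfl fun i _ => ?_
    simp only [Finsupp.add_apply, Finsupp.smul_apply, conjExp_apply, Finsupp.single_apply]
    rw [if_neg (by omega), if_neg (by simp)]
    simp only [smul_eq_mul]
    ring

theorem lead_apply_odd (j : Idx) (u : ℕ) :
    lead j (2 * u + 1) = (j.2 u).toNat + negMult j.2 (2 * u + 1) := by
  have h : (j.2 u).toNat = j.2.sum fun i a => if i = u then a.toNat else 0 := by
    rw [Finsupp.sum_ite_eq' j.2 u fun _ a => a.toNat]
    split_ifs with hu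
    · rfl
    · rw [Finsupp.notMem_support_iff.mp hu]
      rfl
  rw [lead, negMult, Finsupp.add_apply, Finsupp.finsetSum_apply, Finsupp.sum_apply, h,
    ← Finsupp.sum_add, Finset.sum_eq_zero, zero_add]
  · refine Finsupp.sum_congr fun i _ => ?_
    simp only [Finsupp.add_apply, Finsupp.smul_apply, conjExp_apply, Finsupp.single_apply]
    rw [if_pos (odd_two_mul_add_one u)]
    simp
  · intro i _
    rw [Finsupp.single_apply, if_neg (by omega)]

/-- The exponent of `lead (s, f)` at an even index determines, by its parity, the membership in `s`,
and also the value of `negMult f` there. At an odd index `2u + 1`, the value of `negMult f u`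
gives `(f u)⁻ + negMult f (2u + 1)`, and the exponent gives `(f u)⁺ + negMult f (2u + 1)`; their
difference determines `f u`. -/
theorem lead_injective : Function.Injective lead := by
  rintro ⟨s, f⟩ ⟨s', f'⟩ h
  have hE (u : ℕ) := (lead_apply_even (s, f) u).symm.trans
    ((DFunLike.congr_fun h (2 * u)).trans (lead_apply_even (s', f') u))
  have hO (u : ℕ) := (lead_apply_odd (s, f) u).symm.trans
    ((DFunLike.congr_fun h (2 * u + 1)).trans (lead_apply_odd (s', f') u))
  simp only at hE hO
  have hT : ∀ v, negMult f v = negMult f' v := by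
    intro v
    induction v using Nat.strong_induction_on with
    | _ v ih =>
      rcases Nat.even_or_odd' v with ⟨u, rfl | rfl⟩
      · have := hE u
        split_ifs at this <;> omega
      · have h1 := ih u (by omega)
        rw [negMult_eq f, negMult_eq f'] at h1
        have := hO u
        omega
  refine Prod.ext (Finset.ext fun u => ?_) (Finsupp.ext fun u => ?_)
  · have h1 := hE u
    rw [hT (2 * u)] at h1
    split_ifs at h1 <;> first | tauto | omega
  · have h1 := hT u
    rw [negMult_eq f, negMult_eq f'] at h1
    have h2 := hO u
    have h3 := hT (2 * u + 1)
    simp only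
    omega

theorem finite_weight_le (n : ℕ) :
    {m : ℕ →₀ ℕ | Finsupp.weight (fun i : ℕ => i + 1) m ≤ n}.Finite := by
  refine ((Finset.range n).finsupp fun _ => Finset.range (n + 1)).finite_toSet.subset fun m hm => ?_
  rw [Finset.mem_coe, Finset.mem_finsupp_iff]
  refine ⟨fun i hi => Finset.mem_range.mpr ?_, fun i _ => Finset.mem_range_succ_iff.mpr ?_⟩
  · exact (Finsupp.le_weight_of_ne_zero' (fun i : ℕ => i + 1)
      (Finsupp.mem_support_iff.mp hi)).trans hm
  · exact (Finsupp.le_weight (fun i : ℕ => i + 1) i.succ_ne_zero m).trans hm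

/-- The elements `mono j` of degree at most `n` span a space that contains all monomials of degree
at most `n`, and by `lead_injective` there are no more of the former than of the latter. -/
theorem linearIndependent_mono : LinearIndependent (ZMod 2) mono := by
  rw [linearIndependent_iff']
  intro t c hc
  obtain ⟨n, hn⟩ : ∃ n, ∀ j ∈ t, wt j ≤ n := ⟨t.sup wt, fun j hj => Finset.le_sup hj⟩
  have hMfin := finite_weight_le n
  have hmaps : ∀ j ∈ {j : Idx | wt j ≤ n},
      lead j ∈ {m : ℕ →₀ ℕ | Finsupp.weight (fun i : ℕ => i + 1) m ≤ n} := by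
    intro j hj
    rw [Set.mem_ofPred_eq, weight_lead]
    exact hj
  have hJfin : {j : Idx | wt j ≤ n}.Finite :=
    Set.Finite.of_injOn hmaps lead_injective.injOn hMfin
  have hcard := Set.ncard_le_ncard_of_injOn lead hmaps lead_injective.injOn hMfin
  have : Fintype {j : Idx | wt j ≤ n} := hJfin.fintype
  have : Fintype {m : ℕ →₀ ℕ | Finsupp.weight (fun i : ℕ => i + 1) m ≤ n} := hMfin.fintype
  have hli : LinearIndependent (ZMod 2)
      fun j : {j : Idx | wt j ≤ n} => mono j := by
    rw [linearIndependent_iff_card_le_finrank_span]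
    have hM : LinearIndependent (ZMod 2)
        fun m : {m : ℕ →₀ ℕ | Finsupp.weight (fun i : ℕ => i + 1) m ≤ n} =>
          (MvPolynomial.monomial (m : ℕ →₀ ℕ) (1 : ZMod 2) : R) := by
      have := (MvPolynomial.basisMonomials ℕ (ZMod 2)).linearIndependent
      rw [MvPolynomial.coe_basisMonomials] at this
      exact this.comp _ Subtype.val_injective
    rw [← Nat.card_coe_set_eq, ← Nat.card_coe_set_eq, Nat.card_eq_fintype_card,
      Nat.card_eq_fintype_card] at hcard
    refine hcard.trans ?_
    rw [linearIndependent_iff_card_eq_finrank_span.mp hM]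
    have := FiniteDimensional.span_of_finite (ZMod 2)
      (Set.finite_range fun j : {j : Idx | wt j ≤ n} => mono j)
    refine Submodule.finrank_mono (Submodule.span_le.mpr ?_)
    rintro _ ⟨m, rfl⟩
    refine Submodule.span_mono ?_ (gradeR_le_monoSpan _
      (MvPolynomial.isWeightedHomogeneous_monomial _ (m : ℕ →₀ ℕ) 1 rfl))
    rintro _ ⟨j, hj, rfl⟩
    exact ⟨⟨j, hj.trans_le m.2⟩, rfl⟩
  have h := linearIndepOn_finset_iff.mp
    ((show LinearIndepOn (ZMod 2) mono {j : Idx | wt j ≤ n} from hli).mono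
      (t := (t : Set Idx)) hn) c hc
  exact h

theorem span_mono_eq_top : ⊤ ≤ Submodule.span (ZMod 2) (Set.range mono) := by
  intro x _
  rw [x.as_sum]
  refine sum_mem fun m _ => ?_
  exact Submodule.span_mono (Set.image_subset_range _ _) (gradeR_le_monoSpan _
    (MvPolynomial.isWeightedHomogeneous_monomial _ m _ rfl))

/-- The basis of `R` formed by the elements `mono j`. It is permuted by `ω`. -/
def monoBasis : Module.Basis Idx (ZMod 2) R := .mk linearIndependent_mono span_mono_eq_top

theorem monoBasis_apply (j : Idx) : monoBasis j = mono j := Module.Basis.mk_apply _ _ j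

theorem repr_omega (x : R) (j : Idx) : monoBasis.repr (omega x) j = monoBasis.repr x (conj j) := by
  have h : (monoBasis.coord j).comp omega.toLinearMap = monoBasis.coord (conj j) := by
    refine monoBasis.ext fun i => ?_
    rw [LinearMap.comp_apply, AlgHom.toLinearMap_apply, monoBasis_apply, omega_mono,
      ← monoBasis_apply, ← monoBasis_apply, Module.Basis.coord_apply, Module.Basis.coord_apply,
      Module.Basis.repr_self, Module.Basis.repr_self, Finsupp.single_apply, Finsupp.single_apply]
    have : conj i = j ↔ i = conj j :=
      ⟨fun h => by rw [← h, conj_conj], fun h => by rw [h, conj_conj]⟩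
    simp only [this]
  exact LinearMap.congr_fun h x

/-! ### Invariants modulo boundaries -/

/-- The product in `S` of the power sums `p_{2i+1}` with `i ∈ s`. -/
def pProd (s : Finset ℕ) : S := ∏ i ∈ s, pS (2 * i + 1)

theorem coe_pProd (s : Finset ℕ) : (pProd s : R) = monoBasis (s, 0) := by
  rw [monoBasis_apply, pProd, mono, Finsupp.prod_zero_index, mul_one, SubmonoidClass.coe_finsetProd]
  rfl

theorem repr_linearCombination_pProd (c : Finset ℕ →₀ ZMod 2) :
    monoBasis.repr (Finsupp.linearCombination (ZMod 2) pProd c : S) =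
      c.mapDomain fun s => ((s, 0) : Idx) := by
  have h : ((Finsupp.linearCombination (ZMod 2) pProd c : S) : R) =
      Finsupp.linearCombination (ZMod 2) monoBasis (c.mapDomain fun s => ((s, 0) : Idx)) := by
    rw [Finsupp.linearCombination_mapDomain, ← Subalgebra.coe_val, ← AlgHom.toLinearMap_apply,
      ← LinearMap.comp_apply, ← Finsupp.linearCombination_linear_comp]
    congr 2
    funext s
    exact coe_pProd s
  rw [h, Module.Basis.repr_linearCombination]

theorem idx_injective : Function.Injective fun s : Finset ℕ => ((s, 0) : Idx) :=
  fun _ _ h => congrArg Prod.fst h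

/-- An invariant element is a combination of the products of distinct odd power sums plus a
boundary `y + ω(y)`: its coordinates are constant on the orbits of `conj`, and `y` collects one
basis element from each orbit of length two. -/
theorem exists_sub_linearCombination_mem_I (x : S) :
    ∃ c : Finset ℕ →₀ ZMod 2, x - Finsupp.linearCombination (ZMod 2) pProd c ∈ I := by
  classical
  -- The lexicographic comparison of `f` and `-f` selects one element of each orbit.
  let P : Idx → Prop := fun j => toLex j.2 < toLex (-j.2)
  let y : R := monoBasis.repr.symm ((monoBasis.repr (x : R)).filter P)
  refine ⟨(monoBasis.repr (x : R)).comapDomain _ idx_injective.injOn, mem_I.mpr ⟨y, ?_⟩⟩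
  apply monoBasis.repr.injective
  rw [AddSubgroupClass.coe_sub, map_sub, repr_linearCombination_pProd]
  ext ⟨s, f⟩
  have hx : monoBasis.repr (x : R) (s, -f) = monoBasis.repr (x : R) (s, f) := by
    rw [← show conj (s, f) = (s, -f) from rfl, ← repr_omega, mem_S.mp x.2]
  have hy (j : Idx) : monoBasis.repr y j = if P j then monoBasis.repr (x : R) j else 0 := by
    rw [LinearEquiv.apply_symm_apply, Finsupp.filter_apply]
  rw [map_add, Finsupp.add_apply, repr_omega, hy, hy, Finsupp.sub_apply]
  simp only [P, conj, neg_neg, hx]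
  by_cases hf : f = 0
  · subst hf
    rw [Finsupp.mapDomain_apply idx_injective, Finsupp.comapDomain_apply]
    simp
  · have hr : (s, f) ∉ Set.range fun t : Finset ℕ => ((t, 0) : Idx) := by
      rintro ⟨t, ht⟩
      exact hf (congrArg Prod.snd ht).symm
    rw [Finsupp.mapDomain_of_notMem_range _ _ hr, sub_zero]
    have hne : toLex f ≠ toLex (-f) := fun h => hf (self_eq_neg.mp (toLex.injective h))
    rcases lt_or_gt_of_ne hne with h | h
    · rw [if_pos h, if_neg h.not_gt, add_zero]
    · rw [if_neg h.not_gt, if_pos h, zero_add]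

/-- The coordinate of `y + ω(y)` at a basis element fixed by `ω` vanishes. -/
theorem eq_zero_of_linearCombination_mem_I {c : Finset ℕ →₀ ZMod 2}
    (h : Finsupp.linearCombination (ZMod 2) pProd c ∈ I) : c = 0 := by
  obtain ⟨y, hy⟩ := mem_I.mp h
  ext s
  have h1 := DFunLike.congr_fun (congrArg monoBasis.repr hy) (s, 0)
  rw [repr_linearCombination_pProd, Finsupp.mapDomain_apply idx_injective, map_add,
    Finsupp.add_apply, repr_omega, conj, neg_zero, CharTwo.add_self_eq_zero] at h1
  exact h1.symm

/-- The ring `S / I`, sealed so that its only `𝔽₂`-module structure is the one coming from its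
algebra structure. -/
def InvQuot : Type := S ⧸ I

instance : CommRing InvQuot := inferInstanceAs (CommRing (S ⧸ I))

instance : Algebra (ZMod 2) InvQuot := inferInstanceAs (Algebra (ZMod 2) (S ⧸ I))

/-- The projection `S → S / I`. -/
def invMk : S →ₐ[ZMod 2] InvQuot := Ideal.Quotient.mkₐ (ZMod 2) I

theorem invMk_surjective : Function.Surjective invMk := Ideal.Quotient.mk_surjective

theorem invMk_eq_zero_iff {x : S} : invMk x = 0 ↔ x ∈ I := Ideal.Quotient.eq_zero_iff_mem

theorem linearCombination_invMk_pProd (c : Finset ℕ →₀ ZMod 2) :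
    Finsupp.linearCombination (ZMod 2) (fun s => invMk (pProd s)) c =
      invMk (Finsupp.linearCombination (ZMod 2) pProd c) :=
  (Finsupp.apply_linearCombination (ZMod 2) invMk.toLinearMap pProd c).symm

/-- The products of distinct odd power sums form a basis of `S / I`. -/
def invBasis : Module.Basis (Finset ℕ) (ZMod 2) InvQuot :=
  .mk (v := fun s => invMk (pProd s))
    (by
      rw [linearIndependent_iff]
      intro c hc
      rw [linearCombination_invMk_pProd, invMk_eq_zero_iff] at hc
      exact eq_zero_of_linearCombination_mem_I hc)
    (by
      intro x _
      obtain ⟨x, rfl⟩ := invMk_surjective x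
      obtain ⟨c, hc⟩ := exists_sub_linearCombination_mem_I x
      rw [← invMk_eq_zero_iff, map_sub, sub_eq_zero, ← linearCombination_invMk_pProd] at hc
      rw [hc, ← Finsupp.range_linearCombination]
      exact LinearMap.mem_range_self _ c)

theorem invBasis_apply (s : Finset ℕ) : invBasis s = invMk (pProd s) :=
  Module.Basis.mk_apply _ _ s

theorem linearIndependent_pS_odd :
    LinearIndependent (ZMod 2) (fun j : ℕ => pS (2 * j + 1)) := by
  have h := invBasis.linearIndependent.comp (fun i : ℕ => ({i} : Finset ℕ))
    Finset.singleton_injective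
  refine LinearIndependent.of_comp invMk.toLinearMap ?_
  convert h using 1
  funext i
  simp [invBasis_apply, pProd]

/-- The square of an invariant element of positive degree lies in `I`, because it is its norm. -/
theorem sq_mem_I {n : ℕ} (hn : 0 < n) {x : S} (hx : (x : R) ∈ gradeR n) : x ^ 2 ∈ I := by
  obtain ⟨z, -, hz⟩ := exists_lift_norm hn hx
  refine mem_I.mpr ⟨z, ?_⟩
  rw [hz, mem_S.mp x.2, SubmonoidClass.coe_pow, sq]

/-! ### Comparison with the exterior algebra -/

theorem pS_mem_V (i : ℕ) : pS (2 * i + 1) ∈ V :=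
  Submodule.subset_span ⟨2 * i + 1, odd_two_mul_add_one i, rfl⟩

/-- The basis of `V` formed by the odd power sums. -/
def basisV : Module.Basis ℕ (ZMod 2) V :=
  .mk (v := fun i => ⟨pS (2 * i + 1), pS_mem_V i⟩)
    (LinearIndependent.of_comp V.subtype linearIndependent_pS_odd)
    (by
      have h : V = Submodule.span (ZMod 2) (Set.range fun i : ℕ => pS (2 * i + 1)) := by
        rw [V]
        congr 1
        ext x
        constructor
        · rintro ⟨k, ⟨i, rfl⟩, rfl⟩
          exact ⟨i, rfl⟩
        · rintro ⟨i, rfl⟩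
          exact ⟨2 * i + 1, odd_two_mul_add_one i, rfl⟩
      rw [← Submodule.map_le_map_iff_of_injective V.subtype_injective, Submodule.map_subtype_top,
        Submodule.map_span, ← Set.range_comp]
      exact h.le)

theorem coe_basisV (i : ℕ) : (basisV i : S) = pS (2 * i + 1) := by
  rw [basisV, Module.Basis.mk_apply]

theorem sq_mem_I_of_mem_V {v : S} (hv : v ∈ V) : v ^ 2 ∈ I := by
  induction hv using Submodule.span_induction with
  | mem x hx =>
    obtain ⟨k, hk, rfl⟩ := hx
    exact sq_mem_I hk.pos (p_mem_gradeR k)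
  | zero => simp
  | add x y _ _ hx hy =>
    have h : (x + y) ^ 2 = x ^ 2 + y ^ 2 := Subtype.ext (CharTwo.add_sq (x : R) (y : R))
    rw [h]
    exact add_mem hx hy
  | smul c x _ hx => rw [smul_pow]; exact Submodule.smul_of_tower_mem _ _ hx

/-- The homomorphism `⋀ V → S / I` that extends `v ↦ v + I`. -/
def exteriorHom : ExteriorAlgebra (ZMod 2) V →ₐ[ZMod 2] InvQuot :=
  ExteriorAlgebra.lift (ZMod 2) ⟨invMk.toLinearMap ∘ₗ V.subtype, fun v => by
    simp only [LinearMap.comp_apply, AlgHom.toLinearMap_apply, Submodule.subtype_apply]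
    rw [← map_mul, ← sq]
    exact invMk_eq_zero_iff.mpr (sq_mem_I_of_mem_V v.2)⟩

theorem exteriorHom_ι (v : V) : exteriorHom (ExteriorAlgebra.ι (ZMod 2) v) = invMk (v : S) := by
  rw [exteriorHom, ExteriorAlgebra.lift_ι_apply]
  rfl

theorem exteriorHom_basis (s : Finset ℕ) :
    exteriorHom (basisV.ExteriorAlgebra s) = invBasis s := by
  rw [ExteriorAlgebra.basis_apply_ofCard basisV rfl, ExteriorAlgebra.ιMulti_family,
    ExteriorAlgebra.ιMulti_apply, map_list_prod, List.map_ofFn, invBasis_apply, pProd, map_prod]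
  conv_rhs => rw [← Finset.map_orderEmbOfFin_univ s rfl, Finset.prod_map]
  refine List.prod_ofFn.trans (Finset.prod_congr rfl fun i _ => ?_)
  rw [Function.comp_apply, exteriorHom_ι, Function.comp_apply, coe_basisV]
  rfl

theorem exteriorHom_bijective : Function.Bijective exteriorHom := by
  have h : exteriorHom.toLinearMap =
      (basisV.ExteriorAlgebra.equiv invBasis (Equiv.refl _)).toLinearMap := by
    refine basisV.ExteriorAlgebra.ext fun s => ?_
    rw [AlgHom.toLinearMap_apply, exteriorHom_basis, LinearEquiv.coe_coe,
      Module.Basis.equiv_apply, Equiv.refl_apply]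
  have h2 : (exteriorHom : ExteriorAlgebra (ZMod 2) V → InvQuot) =
      basisV.ExteriorAlgebra.equiv invBasis (Equiv.refl _) :=
    funext fun x => LinearMap.congr_fun h x
  rw [h2]
  exact LinearEquiv.bijective _

/-! ### Comparison with the ring of power sums -/

theorem derivative_derivative (f : PowerSeries R) :
    PowerSeries.derivative R (PowerSeries.derivative R f) = 0 := by
  ext1 n
  have h : ((n + 1 : ℕ) : R) * ((n + 1 + 1 : ℕ) : R) = 0 := by
    rw [← Nat.cast_mul, CharP.cast_eq_zero_iff R 2]
    exact (Nat.even_mul_succ_self (n + 1)).two_dvd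
  rw [PowerSeries.coeff_derivative, PowerSeries.coeff_derivative, map_zero]
  push_cast at h ⊢
  linear_combination PowerSeries.coeff (n + 1 + 1) f * h

/-- Differentiating the Newton identity `P W = T W'` gives `P = T P' + P ^ 2`, since `W'' = 0`
in characteristic two. The coefficients of even degree of `T P'` vanish. -/
theorem p_two_mul (k : ℕ) : p (2 * k) = p k ^ 2 := by
  have key : PowerSeries.mk p =
      PowerSeries.X * PowerSeries.derivative R (PowerSeries.mk p) + PowerSeries.mk p ^ 2 := by
    have h1 := mk_p_mul_mk_w
    have h2 := congrArg (PowerSeries.derivative R) h1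
    rw [Derivation.leibniz, Derivation.leibniz, derivative_derivative,
      PowerSeries.derivative_X] at h2
    simp only [smul_eq_mul] at h2
    have hw := mk_w_mul_mk_wBar
    generalize PowerSeries.derivative R (PowerSeries.mk p) = P' at *
    generalize PowerSeries.derivative R (PowerSeries.mk w) = W' at *
    generalize PowerSeries.mk p = P at *
    generalize PowerSeries.mk w = W at *
    generalize PowerSeries.mk wBar = U at *
    linear_combination (PowerSeries.X * P' + P ^ 2 - P) * hw - PowerSeries.X * U * h2 +
      (U - P * U) * h1
  have h := congrArg (PowerSeries.coeff (2 * k)) key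
  have hX : PowerSeries.coeff (2 * k)
      (PowerSeries.X * PowerSeries.derivative R (PowerSeries.mk p)) = 0 := by
    cases k with
    | zero => simp
    | succ k =>
      rw [show 2 * (k + 1) = 2 * k + 1 + 1 by ring, PowerSeries.coeff_succ_X_mul,
        PowerSeries.coeff_derivative]
      have h0 : ((2 * k + 1 : ℕ) : R) + 1 = 0 := by
        rw [← Nat.cast_succ, CharP.cast_eq_zero_iff R 2]
        omega
      rw [h0, mul_zero]
  rw [map_add, hX, zero_add, PowerSeries.coeff_mk, sq, PowerSeries.coeff_mul,
    Finset.Nat.sum_antidiagonal_eq_sum_range_succ_mk, sum_range_fold, Finset.sum_eq_zero,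
    zero_add] at h
  · simpa [show 2 * k - k = k by omega, sq] using h
  · intro i hi
    have hi := Finset.mem_range.mp hi
    rw [show 2 * k - (2 * k - i) = i by omega, mul_comm, CharTwo.add_self_eq_zero]

theorem p_mem_PS {k : ℕ} (hk : 0 < k) : p k ∈ PS := Algebra.subset_adjoin ⟨k, hk, rfl⟩

/-- The power sum `p_{k+1}` as an element of `PS`. -/
def pPS (k : ℕ) : PS := ⟨p (k + 1), p_mem_PS k.succ_pos⟩

theorem pPS_sq_mem_QPS (k : ℕ) : pPS k ^ 2 ∈ QPS :=
  Ideal.subset_span ⟨k + 1, k.succ_pos, pPS k, p_mem_gradeR (k + 1), rfl⟩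

/-- The ring `PS / Q(PS)`, sealed so that its only `𝔽₂`-module structure is the one coming from
its algebra structure. -/
def PowQuot : Type := PS ⧸ QPS

instance : CommRing PowQuot := inferInstanceAs (CommRing (PS ⧸ QPS))

instance : Algebra (ZMod 2) PowQuot := inferInstanceAs (Algebra (ZMod 2) (PS ⧸ QPS))

/-- The projection `PS → PS / Q(PS)`. -/
def powMk : PS →ₐ[ZMod 2] PowQuot := Ideal.Quotient.mkₐ (ZMod 2) QPS

theorem powMk_surjective : Function.Surjective powMk := Ideal.Quotient.mk_surjective

theorem powMk_pPS_sq (k : ℕ) : powMk (pPS k) ^ 2 = 0 := by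
  rw [← map_pow]
  exact Ideal.Quotient.eq_zero_iff_mem.mpr (pPS_sq_mem_QPS k)

/-- The product in `PS / Q(PS)` of the power sums `p_{2i+1}` with `i ∈ s`. -/
def powProd (s : Finset ℕ) : PowQuot := ∏ i ∈ s, powMk (pPS (2 * i))

theorem powMk_mul_powProd_mem (k : ℕ) (s : Finset ℕ) :
    powMk (pPS k) * powProd s ∈ Submodule.span (ZMod 2) (Set.range powProd) := by
  rcases Nat.even_or_odd' k with ⟨i, rfl | rfl⟩
  · by_cases hi : i ∈ s
    · rw [powProd, ← Finset.mul_prod_erase s _ hi, ← mul_assoc, ← sq, powMk_pPS_sq, zero_mul]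
      exact zero_mem _
    · refine Submodule.subset_span ⟨insert i s, ?_⟩
      rw [powProd, Finset.prod_insert hi, powProd]
  · have h : pPS (2 * i + 1) = pPS i ^ 2 := Subtype.ext (p_two_mul (i + 1))
    rw [h, map_pow, powMk_pPS_sq, zero_mul]
    exact zero_mem _

/-- Modulo the ideal of squares, `PS` is spanned by the products of distinct odd power sums. -/
theorem span_powProd : Submodule.span (ZMod 2) (Set.range powProd) = ⊤ := by
  set T := Submodule.span (ZMod 2) (Set.range powProd)
  have hmul : ∀ k, ∀ y ∈ T, powMk (pPS k) * y ∈ T := by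
    intro k y hy
    induction hy using Submodule.span_induction with
    | mem y hy =>
      obtain ⟨s, rfl⟩ := hy
      exact powMk_mul_powProd_mem k s
    | zero => rw [mul_zero]; exact zero_mem _
    | add x y _ _ hx hy => rw [mul_add]; exact add_mem hx hy
    | smul c x _ hx => rw [mul_smul_comm]; exact Submodule.smul_mem _ _ hx
  have hone : (1 : PowQuot) ∈ T := Submodule.subset_span ⟨∅, rfl⟩
  rw [eq_top_iff]
  rintro x -
  obtain ⟨⟨x, hx⟩, rfl⟩ := powMk_surjective x
  suffices h : ∀ y ∈ T, powMk ⟨x, hx⟩ * y ∈ T by simpa using h 1 hone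
  induction hx using Algebra.adjoin_induction with
  | mem x hx =>
    obtain ⟨k, hk, rfl⟩ := hx
    obtain ⟨k, rfl⟩ : ∃ m, k = m + 1 := ⟨k - 1, by omega⟩
    exact hmul k
  | algebraMap c =>
    intro y hy
    have h : powMk ⟨algebraMap (ZMod 2) R c, _⟩ = algebraMap (ZMod 2) PowQuot c := powMk.commutes c
    rw [h, ← Algebra.smul_def]
    exact Submodule.smul_mem T c hy
  | add x x' hx hx' h h' =>
    intro y hy
    have := add_mem (h y hy) (h' y hy)
    rwa [← add_mul, ← map_add] at this
  | mul x x' hx hx' h h' =>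
    intro y hy
    have := h _ (h' y hy)
    rwa [← mul_assoc, ← map_mul] at this

theorem QPS_le_ker (x : PS) (hx : x ∈ QPS) :
    (invMk.comp (Subalgebra.inclusion PS_le_S)) x = 0 := by
  have h : QPS ≤ RingHom.ker (invMk.comp (Subalgebra.inclusion PS_le_S)) := by
    refine Ideal.span_le.mpr ?_
    rintro _ ⟨n, hn, x, hx, rfl⟩
    have hI : Subalgebra.inclusion PS_le_S x ^ 2 ∈ I := sq_mem_I hn hx
    rw [← map_pow] at hI
    exact invMk_eq_zero_iff.mpr hI
  exact h hx

/-- The homomorphism `PS / Q(PS) → S / I` induced by the inclusion. -/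
def powerSumHom : PowQuot →ₐ[ZMod 2] InvQuot :=
  Ideal.Quotient.liftₐ QPS (invMk.comp (Subalgebra.inclusion PS_le_S)) QPS_le_ker

theorem powerSumHom_powMk (x : PS) :
    powerSumHom (powMk x) = invMk (Subalgebra.inclusion PS_le_S x) := rfl

theorem powerSumHom_powProd (s : Finset ℕ) : powerSumHom (powProd s) = invBasis s := by
  rw [powProd, map_prod, invBasis_apply, pProd, map_prod]
  rfl

theorem powerSumHom_bijective : Function.Bijective powerSumHom := by
  constructor
  · rw [injective_iff_map_eq_zero]
    intro x hx
    have hmem : x ∈ Submodule.span (ZMod 2) (Set.range powProd) :=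
      span_powProd.ge Submodule.mem_top
    rw [← Finsupp.range_linearCombination] at hmem
    obtain ⟨c, rfl⟩ := hmem
    rw [← AlgHom.toLinearMap_apply, Finsupp.apply_linearCombination,
      show powerSumHom.toLinearMap ∘ powProd = invBasis from funext powerSumHom_powProd] at hx
    rw [linearIndependent_iff.mp invBasis.linearIndependent c hx, map_zero]
  · have h : LinearMap.range powerSumHom.toLinearMap = ⊤ := by
      rw [eq_top_iff, ← invBasis.span_eq, Submodule.span_le]
      rintro _ ⟨s, rfl⟩
      exact ⟨_, powerSumHom_powProd s⟩
    exact LinearMap.range_eq_top.mp h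

end SymInv

theorem mainTheorem3 :
    LinearIndependent (ZMod 2) (fun j : ℕ => SymInv.pS (2 * j + 1)) ∧
    (∃ φ : ExteriorAlgebra (ZMod 2) SymInv.V ≃ₐ[ZMod 2] (SymInv.S ⧸ SymInv.I),
      ∀ v : SymInv.V, φ (ExteriorAlgebra.ι (ZMod 2) v) = Ideal.Quotient.mk SymInv.I (v : SymInv.S)) ∧
    (∃ ψ : (SymInv.PS ⧸ SymInv.QPS) ≃ₐ[ZMod 2] (SymInv.S ⧸ SymInv.I),
      ∀ x : SymInv.PS, ψ (Ideal.Quotient.mk SymInv.QPS x) =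
        Ideal.Quotient.mk SymInv.I (Subalgebra.inclusion SymInv.PS_le_S x)) :=
  ⟨SymInv.linearIndependent_pS_odd,
    ⟨(AlgEquiv.ofBijective SymInv.exteriorHom SymInv.exteriorHom_bijective :
      ExteriorAlgebra (ZMod 2) SymInv.V ≃ₐ[ZMod 2] SymInv.InvQuot), SymInv.exteriorHom_ι⟩,
    ⟨(AlgEquiv.ofBijective SymInv.powerSumHom SymInv.powerSumHom_bijective :
      SymInv.PowQuot ≃ₐ[ZMod 2] SymInv.InvQuot), SymInv.powerSumHom_powMk⟩⟩

end
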